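/- Let $p$ be an odd prime and let $G$ be a finite $p$-group of nilpotency class $c$. Write $\exp(H)$ for the exponent of a finite group $H$ (the least common multiple of the orders of its elements) and $\mathcal{B}(H)=\{h\in H : |h|=\exp(H)\}$ for its set of big elements. Let $\gamma_1(G)=G$, $\gamma_{i+1}(G)=[G,\gamma_i(G)]$ be the lower central series of $G$. An element $k\in G$ of order $n$ is called a witness for $G$ if $$\prod_{i=1}^{n} xk^{n-i}=(xk^{n-1})(xk^{n-2})\cdots(xk)\,x=1\quad\text{for all }x\in G,$$ and $\mathcal{W}(G)$ denotes the set of witnesses for $G$. The group $G$ is called a $J$-group if there are an element $k\in G$ and a function $f\colon G\to G$ such that $f(xk)=xf(x)$ for all $x\in G$. (a) If $p>2c-1$, then $\mathcal{B}(G)\subseteq\mathcal{W}(G)$, and $G$ is a $J$-group. (b) If $p^2>2c-1$, then $G$ is a $J$-group; moreover, if $G\neq 1$, then there is a largest integer $d\ge 1$ such that $\exp(\gamma_d(G))=\exp(G)$, and for this $d$ we have $\mathcal{B}(\gamma_d(G))\subseteq\mathcal{W}(G)$. -/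

import Mathlib

/-- A group `G` is a `J`-group if there are an element `k` of `G` and a function `f : G → G`
with `f (x * k) = x * f x` for all `x`. -/
def IsJGroup (G : Type*) [Group G] : Prop :=
  ∃ (k : G) (f : G → G), ∀ x : G, f (x * k) = x * f x

/-- An element `k` of finite order `n` is a witness if the ordered product
`(x k^(n-1)) (x k^(n-2)) ⋯ (x k) x`, with factors `x k^(n-i)` for `i = 1, …, n`,
is trivial for all `x`. -/
def IsWitness {G : Type*} [Group G] (k : G) : Prop :=
  IsOfFinOrder k ∧ ∀ x : G,
    ((List.range' 1 (orderOf k)).map (fun i => x * k ^ (orderOf k - i))).prod = 1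

/-- The set of witnesses of `G`. -/
def witnesses (G : Type*) [Group G] : Set G := {k | IsWitness k}

/-- The set of big elements of `G`: those whose order is the exponent of `G`. -/
def bigElements (G : Type*) [Group G] : Set G := {k | orderOf k = Monoid.exponent G}

/-- The term `γ_i(G)` of the lower central series, numbered so that `γ_1(G) = G`
(only used for `1 ≤ i`). -/
def gam (G : Type*) [Group G] (i : ℕ) : Subgroup G :=
  (⊤ : Subgroup G).lowerCentralSeries (i - 1)

/-! Let `n` be the order of `k`. Moving powers of `k` to the right turns the witness product into
`triangularProd x k n` times `k ^ -C(n+1, 2)`, and the last factor is trivial for odd `n`. The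
triangular product is a polynomial sequence for a filtration giving `x` weight 1 and `k` weight 2,
because `k` occurs with exponents quadratic in the index. Hence it has a Taylor expansion `∏ a_i ^
C(n, i)` with `a_i` of weight `i`.

Take `n = exp G`. The factor `i = 0` is trivial, and `n` divides `C(n, i)` for `i = 1, 2`. For `i ≥
2c` the term `a_i` lies in `L c = ⊥`. For `3 ≤ i < 2c` it lies in `L (d + 1)`, where `k ∈ L d`. If
`2c ≤ p`, then `n ∣ C(n, i)`; if `2c ≤ p ^ 2`, at worst one factor `p` is lost, which is harmless
when `L (d + 1)` has smaller exponent. The key results are `polyClosed`, `IsPolySeq.exists_taylor`,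
`commutator_weightFiltration_le` and `triangularProd_eq_one`. -/

open scoped commutatorElement

/-! ### Polynomial sequences in a filtered group (Lazard–Leibman) and Taylor expansion -/

section PolynomialSequences

variable {G : Type*} [Group G]

/-- The discrete multiplicative derivative of a sequence in a group. -/
def mulDiff (g : ℕ → G) : ℕ → G := fun n => (g n)⁻¹ * g (n + 1)

/-- The first `j` iterated derivatives of `g` take values in `F s, F (s + 1), …, F (s + j)`. -/
def IsPolySeq (F : ℕ → Subgroup G) : ℕ → ℕ → (ℕ → G) → Prop
  | 0, s, g => ∀ n, g n ∈ F s
  | j + 1, s, g => (∀ n, g n ∈ F s) ∧ IsPolySeq F j (s + 1) (mulDiff g)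

variable {F : ℕ → Subgroup G}

theorem IsPolySeq.mem {j s : ℕ} {g : ℕ → G} (h : IsPolySeq F j s g) (n : ℕ) : g n ∈ F s := by
  cases j with
  | zero => exact h n
  | succ j => exact h.1 n

theorem IsPolySeq.of_succ {j s : ℕ} {g : ℕ → G} (h : IsPolySeq F (j + 1) s g) :
    IsPolySeq F j s g := by
  induction j generalizing s g with
  | zero => exact h.1
  | succ j ih => exact ⟨h.1, ih h.2⟩

theorem IsPolySeq.mono (hF : Antitone F) {j s t : ℕ} (hst : s ≤ t) {g : ℕ → G}
    (h : IsPolySeq F j t g) : IsPolySeq F j s g := by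
  induction j generalizing s t g with
  | zero => exact fun n => hF hst (h n)
  | succ j ih => exact ⟨fun n => hF hst (h.1 n), ih (Nat.succ_le_succ hst) h.2⟩

theorem mulDiff_mul (g h : ℕ → G) :
    mulDiff (g * h) = ⁅h⁻¹, mulDiff g⁆ * mulDiff g * mulDiff h := by
  funext n
  simp only [mulDiff, Pi.mul_apply, commutatorElement_def, Pi.inv_apply]
  group

theorem mulDiff_inv (g : ℕ → G) :
    mulDiff g⁻¹ = ⁅g, (mulDiff g)⁻¹⁆ * (mulDiff g)⁻¹ := by
  funext n
  simp only [mulDiff, Pi.mul_apply, commutatorElement_def, Pi.inv_apply]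
  group

theorem mulDiff_commutator (g h : ℕ → G) :
    mulDiff ⁅g, h⁆ =
      (⁅g, h⁆⁻¹ * (g * (⁅mulDiff g, h⁆ * (h * ⁅mulDiff g, mulDiff h⁆ * h⁻¹)) * g⁻¹) * ⁅g, h⁆⁻¹⁻¹) *
        (h * ⁅g, mulDiff h⁆ * h⁻¹) := by
  funext n
  simp only [mulDiff, Pi.mul_apply, commutatorElement_def, Pi.inv_apply]
  group

/-- Truncated polynomial sequences of order `j` are closed under the group operations. -/
structure PolyClosed (F : ℕ → Subgroup G) (j : ℕ) : Prop where
  mul : ∀ {s : ℕ} {g h : ℕ → G}, IsPolySeq F j s g → IsPolySeq F j s h → IsPolySeq F j s (g * h)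
  inv : ∀ {s : ℕ} {g : ℕ → G}, IsPolySeq F j s g → IsPolySeq F j s g⁻¹
  comm : ∀ {s t : ℕ} {g h : ℕ → G}, IsPolySeq F j s g → IsPolySeq F j t h →
    IsPolySeq F j (s + t) ⁅g, h⁆

theorem PolyClosed.conj {j : ℕ} (H : PolyClosed F j) (hF : Antitone F) {s t : ℕ} {g h : ℕ → G}
    (hg : IsPolySeq F j s g) (hh : IsPolySeq F j t h) : IsPolySeq F j t (g * h * g⁻¹) := by
  have h1 : g * h * g⁻¹ = ⁅g, h⁆ * h := by simp [commutatorElement_def]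
  rw [h1]
  exact H.mul ((H.comm hg hh).mono hF (Nat.le_add_left t s)) hh

/-- The three closure properties need one joint induction: the derivative of a product, inverse or
commutator is a word in sequences and derivatives of lower truncation order, each factor having
weight at least one higher. -/
theorem polyClosed (hF : Antitone F) (hcomm : ∀ i j, ⁅F i, F j⁆ ≤ F (i + j)) (j : ℕ) :
    PolyClosed F j := by
  have hc : ∀ {s t : ℕ} {g h : G}, g ∈ F s → h ∈ F t → ⁅g, h⁆ ∈ F (s + t) := fun hg hh =>
    hcomm _ _ (Subgroup.commutator_mem_commutator hg hh)
  induction j with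
  | zero =>
    exact ⟨fun hg hh n => mul_mem (hg n) (hh n), fun hg n => inv_mem (hg n),
      fun hg hh n => hc (hg n) (hh n)⟩
  | succ j ih =>
    refine ⟨fun {s g h} hg hh => ⟨fun n => mul_mem (hg.1 n) (hh.1 n), ?_⟩,
      fun {s g} hg => ⟨fun n => inv_mem (hg.1 n), ?_⟩,
      fun {s t g h} hg hh => ⟨fun n => hc (hg.1 n) (hh.1 n), ?_⟩⟩
    · rw [mulDiff_mul]
      exact ih.mul (ih.mul ((ih.comm (ih.inv hh.of_succ) hg.2).mono hF (by omega)) hg.2) hh.2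
    · rw [mulDiff_inv]
      exact ih.mul ((ih.comm hg.of_succ (ih.inv hg.2)).mono hF (by omega)) (ih.inv hg.2)
    · rw [mulDiff_commutator]
      have hg' := hg.of_succ
      have hh' := hh.of_succ
      have huh := (ih.comm hg.2 hh').mono (s := s + t + 1) hF (by omega)
      have huv := (ih.comm hg.2 hh.2).mono (s := s + t + 1) hF (by omega)
      have hgv := (ih.comm hg' hh.2).mono (s := s + t + 1) hF (by omega)
      exact ih.mul (ih.conj hF (ih.inv (ih.comm hg' hh'))
        (ih.conj hF hg' (ih.mul huh (ih.conj hF hh' huv)))) (ih.conj hF hh' hgv)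

theorem isPolySeq_one (j s : ℕ) : IsPolySeq F j s 1 := by
  induction j generalizing s with
  | zero => exact fun n => one_mem _
  | succ j ih =>
    refine ⟨fun n => one_mem _, ?_⟩
    convert ih (s + 1) using 1
    funext n
    simp [mulDiff]

theorem mulDiff_const (a : G) : mulDiff (fun _ => a) = 1 := by
  funext n
  simp [mulDiff]

theorem isPolySeq_const {a : G} {s : ℕ} (ha : a ∈ F s) (j : ℕ) : IsPolySeq F j s fun _ => a := by
  cases j with
  | zero => exact fun _ => ha
  | succ j => exact ⟨fun _ => ha, by rw [mulDiff_const]; exact isPolySeq_one _ _⟩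

theorem mulDiff_pow_choose (a : G) (m : ℕ) :
    mulDiff (fun n => a ^ n.choose (m + 1)) = fun n => a ^ n.choose m := by
  funext n
  simp only [mulDiff]
  rw [inv_mul_eq_iff_eq_mul, ← pow_add, Nat.choose_succ_succ', add_comm]

theorem isPolySeq_pow_choose (hF : Antitone F) {a : G} {m s : ℕ} (ha : a ∈ F (s + m)) (j : ℕ) :
    IsPolySeq F j s fun n => a ^ n.choose m := by
  induction m generalizing j s with
  | zero => simpa using isPolySeq_const ha j
  | succ m ih =>
    have hmem : ∀ n : ℕ, a ^ n.choose (m + 1) ∈ F s := fun n =>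
      pow_mem (hF (Nat.le_add_right s (m + 1)) ha) _
    cases j with
    | zero => exact hmem
    | succ j =>
      refine ⟨hmem, ?_⟩
      rw [mulDiff_pow_choose]
      exact ih (by convert ha using 2; omega) j

/-- When the earlier values vanish, the `m`-th derivative at 0 is just `r m`. -/
theorem IsPolySeq.apply_mem_of_eq_one {m s : ℕ} {r : ℕ → G} (h : IsPolySeq F m s r)
    (hr : ∀ i < m, r i = 1) : r m ∈ F (s + m) := by
  induction m generalizing s r with
  | zero => exact h 0
  | succ m ih =>
    have h1 := ih h.2 fun i hi => by simp [mulDiff, hr i (by omega), hr (i + 1) (by omega)]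
    simp only [mulDiff, hr m (by omega), inv_one, one_mul] at h1
    convert h1 using 2
    omega

/-- Taylor expansion of polynomial sequences. -/
theorem IsPolySeq.exists_taylor (hF : Antitone F) (hcomm : ∀ i j, ⁅F i, F j⁆ ≤ F (i + j))
    {g : ℕ → G} (hg : ∀ j, IsPolySeq F j 0 g) (m : ℕ) :
    ∃ a : ℕ → G, (∀ i, a i ∈ F i) ∧
      ∀ n < m, g n = ((List.range m).map fun i => a i ^ n.choose i).prod := by
  suffices H : ∃ (a : ℕ → G) (r : ℕ → G), (∀ i, a i ∈ F i) ∧ (∀ j, IsPolySeq F j 0 r) ∧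
      (∀ n < m, r n = 1) ∧
      ∀ n, g n = ((List.range m).map fun i => a i ^ n.choose i).prod * r n by
    obtain ⟨a, r, ha, -, hr, h⟩ := H
    exact ⟨a, ha, fun n hn => by rw [h, hr n hn, mul_one]⟩
  induction m with
  | zero => exact ⟨1, g, fun _ => one_mem _, hg, by simp, by simp⟩
  | succ m ih =>
    obtain ⟨a, r, ha, hr, hr1, h⟩ := ih
    have hrm : r m ∈ F m := by simpa using (hr m).apply_mem_of_eq_one hr1
    -- The first nontrivial value of the remainder is the next coefficient; dividing by its binomial
    -- power kills the remainder at `m` and changes nothing below.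
    refine ⟨Function.update a m (r m), (fun n => r m ^ n.choose m)⁻¹ * r, fun i => ?_, fun j => ?_,
      fun n hn => ?_, fun n => ?_⟩
    · rcases eq_or_ne i m with rfl | hi
      · simpa using hrm
      · simpa [hi] using ha i
    · have H := polyClosed hF hcomm j
      exact H.mul (H.inv (isPolySeq_pow_choose hF (by simpa using hrm) j)) (hr j)
    · rcases Nat.lt_succ_iff_lt_or_eq.1 hn with hn | rfl
      · simp [hr1 n hn, Nat.choose_eq_zero_of_lt hn]
      · simp
    · rw [h n, List.range_succ, List.map_append, List.prod_append]
      have : (List.range m).map (fun i => Function.update a m (r m) i ^ n.choose i) =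
          (List.range m).map fun i => a i ^ n.choose i := by
        refine List.map_congr_left fun i hi => ?_
        rw [Function.update_of_ne (List.mem_range.1 hi).ne]
      rw [this]
      simp [mul_assoc]

end PolynomialSequences

/-! ### The weighted refinement of the lower central series -/

section Filtration

variable {G : Type*} [Group G]

theorem commutatorElement_mem_iff_commute {M : Subgroup G} [M.Normal] {a b : G} :
    ⁅a, b⁆ ∈ M ↔ Commute (a : G ⧸ M) (b : G ⧸ M) := by
  rw [← QuotientGroup.eq_one_iff, ← commutatorElement_eq_one_iff_commute]
  rfl

theorem commutator_closure_closure_le {M : Subgroup G} [M.Normal] {S T : Set G}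
    (h : ∀ a ∈ S, ∀ b ∈ T, ⁅a, b⁆ ∈ M) :
    ⁅Subgroup.closure S, Subgroup.closure T⁆ ≤ M := by
  rw [Subgroup.commutator_le]
  intro a ha b hb
  simp only [commutatorElement_mem_iff_commute] at h ⊢
  induction ha using Subgroup.closure_induction with
  | one => exact Commute.one_left _
  | mul y z _ _ h1 h2 => exact h1.mul_left h2
  | inv y _ h1 => exact h1.inv_left
  | mem y hy =>
    induction hb using Subgroup.closure_induction with
    | mem z hz => exact h y hy z hz
    | one => exact Commute.one_right _
    | mul z w _ _ h1 h2 => exact h1.mul_right h2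
    | inv z _ h1 => exact h1.inv_right

/-- The three subgroups lemma, read in `G ⧸ N`. -/
theorem commutator_commutator_le_of_rotate {N H₁ H₂ H₃ : Subgroup G} [N.Normal]
    (h1 : ⁅⁅H₂, H₃⁆, H₁⁆ ≤ N) (h2 : ⁅⁅H₃, H₁⁆, H₂⁆ ≤ N) : ⁅⁅H₁, H₂⁆, H₃⁆ ≤ N := by
  have key : ∀ K : Subgroup G, K ≤ N ↔ K.map (QuotientGroup.mk' N) = ⊥ := fun K => by
    rw [Subgroup.map_eq_bot_iff, QuotientGroup.ker_mk']
  simp only [key, Subgroup.map_commutator] at h1 h2 ⊢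
  exact Subgroup.commutator_commutator_eq_bot_of_rotate h1 h2

local notation "L" => Subgroup.lowerCentralSeries (⊤ : Subgroup G)

theorem commutator_lowerCentralSeries_le (i j : ℕ) : ⁅L i, L j⁆ ≤ L (i + j + 1) := by
  induction i generalizing j with
  | zero =>
    rw [Subgroup.lowerCentralSeries_zero, Subgroup.commutator_comm, Nat.zero_add]
    exact le_rfl
  | succ i ih =>
    rw [Subgroup.lowerCentralSeries_succ]
    refine commutator_commutator_le_of_rotate ?_ ?_
    · rw [Subgroup.commutator_comm ⊤, ← Subgroup.lowerCentralSeries_succ, Subgroup.commutator_comm]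
      exact (ih (j + 1)).trans_eq (by congr 1; omega)
    · rw [Subgroup.commutator_comm (L j)]
      exact (Subgroup.commutator_mono (ih j) le_rfl).trans_eq
        (by rw [← Subgroup.lowerCentralSeries_succ]; congr 1; omega)

theorem commutatorElement_mem_lowerCentralSeries {i j m : ℕ} (hm : m ≤ i + j + 1) {a b : G}
    (ha : a ∈ L i) (hb : b ∈ L j) : ⁅a, b⁆ ∈ L m :=
  Subgroup.lowerCentralSeries_antitone _ hm
    (commutator_lowerCentralSeries_le i j (Subgroup.commutator_mem_commutator ha hb))

/-- A filtration in which `x` has weight one, `k` has weight two, and which otherwise refines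
the lower central series, starting at its term of index `d + 1`. -/
def weightFiltration (x k : G) (d : ℕ) : ℕ → Subgroup G
  | 0 | 1 => Subgroup.closure ({x, k} ∪ (L (d + 1) : Set G))
  | 2 => Subgroup.closure ({k} ∪ (L (d + 1) : Set G))
  | m + 3 => L (max (d + 1) ((m + 3) / 2))

theorem weightFiltration_of_three_le (x k : G) (d : ℕ) {m : ℕ} (hm : 3 ≤ m) :
    weightFiltration x k d m = L (max (d + 1) (m / 2)) := by
  obtain ⟨m, rfl⟩ := Nat.exists_eq_add_of_le' hm
  rfl

theorem weightFiltration_antitone (x k : G) (d : ℕ) : Antitone (weightFiltration x k d) := by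
  refine antitone_nat_of_succ_le fun n => ?_
  match n with
  | 0 => exact le_rfl
  | 1 => exact Subgroup.closure_mono (Set.union_subset_union_left _ (by simp))
  | 2 =>
    refine (Subgroup.lowerCentralSeries_antitone _ (le_max_left _ _)).trans ?_
    exact fun y hy => Subgroup.subset_closure (Or.inr hy)
  | n + 3 => exact Subgroup.lowerCentralSeries_antitone _ (by omega)

theorem commutator_weightFiltration_le (x : G) {k : G} {d : ℕ} (hk : k ∈ L d) (i j : ℕ) :
    ⁅weightFiltration x k d i, weightFiltration x k d j⁆ ≤ weightFiltration x k d (i + j) := by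
  have top : ∀ y : G, y ∈ L 0 := fun y => Subgroup.mem_top y
  have hxk : ⁅x, k⁆ ∈ L (d + 1) :=
    commutatorElement_mem_lowerCentralSeries (by omega) (top x) hk
  have hkx : ⁅k, x⁆ ∈ L (d + 1) :=
    commutatorElement_mem_lowerCentralSeries (by omega) hk (top x)
  have anti : ∀ {a b : ℕ}, a ≤ b → L b ≤ L a := fun h =>
    Subgroup.lowerCentralSeries_antitone _ h
  have h11 : ⁅weightFiltration x k d 1, weightFiltration x k d 1⁆ ≤ L (d + 1) := by
    refine commutator_closure_closure_le fun a ha b hb => ?_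
    rcases ha with (rfl | rfl) | ha
    · rcases hb with (rfl | rfl) | hb
      · simp
      · exact hxk
      · exact commutatorElement_mem_lowerCentralSeries (by omega) (top _) hb
    · rcases hb with (rfl | rfl) | hb
      · exact hkx
      · simp
      · exact commutatorElement_mem_lowerCentralSeries (by omega) (top _) hb
    · exact commutatorElement_mem_lowerCentralSeries (by omega) ha (top _)
  have h22 : ⁅weightFiltration x k d 2, weightFiltration x k d 2⁆ ≤ L (d + 2) := by
    refine commutator_closure_closure_le fun a ha b hb => ?_
    rcases ha with rfl | ha
    · rcases hb with rfl | hb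
      · simp
      · exact commutatorElement_mem_lowerCentralSeries (by omega) (top _) hb
    · exact commutatorElement_mem_lowerCentralSeries (by omega) ha (top _)
  have le2 : weightFiltration x k d 2 ≤ L d := by
    refine (Subgroup.closure_le _).2 ?_
    rintro a (rfl | ha)
    · exact hk
    · exact anti (Nat.le_succ d) ha
  have hbig : ∀ {A : Subgroup G} {a j m : ℕ}, A ≤ L a → 3 ≤ j → 3 ≤ m →
      max (d + 1) (m / 2) ≤ a + max (d + 1) (j / 2) + 1 →
      ⁅A, weightFiltration x k d j⁆ ≤ weightFiltration x k d m := by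
    intro A a j m hA hj hm h
    rw [weightFiltration_of_three_le _ _ _ hj, weightFiltration_of_three_le _ _ _ hm]
    exact (Subgroup.commutator_mono hA le_rfl).trans
      ((commutator_lowerCentralSeries_le _ _).trans (anti h))
  have htop : ∀ A : Subgroup G, A ≤ L 0 := fun A => le_top
  have h01 : weightFiltration x k d 0 = weightFiltration x k d 1 := rfl
  have hL : ∀ {m : ℕ}, m ≤ 3 → L (d + 1) ≤ weightFiltration x k d m := fun {m} hm => by
    refine le_trans ?_ (weightFiltration_antitone x k d hm)
    rw [weightFiltration_of_three_le _ _ _ le_rfl]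
    exact anti (by omega)
  wlog hij : i ≤ j generalizing i j
  · rw [Subgroup.commutator_comm, add_comm]
    exact this j i (by omega)
  rcases Nat.lt_or_ge j 3 with hj | hj
  · have hle : ∀ {m : ℕ}, weightFiltration x k d m ≤ weightFiltration x k d 1 := fun {m} => by
      cases m with
      | zero => exact le_rfl
      | succ m => exact weightFiltration_antitone x k d (by omega)
    rcases Nat.lt_or_ge (i + j) 4 with h4 | h4
    · exact ((Subgroup.commutator_mono hle hle).trans h11).trans (hL (by omega))
    -- Weight 4 requires `L 2` even when `d = 0`. This holds because `k` commutes with itself, so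
    -- every generating commutator involves `L (d + 1)`.
    · obtain ⟨rfl, rfl⟩ : i = 2 ∧ j = 2 := by omega
      refine h22.trans ?_
      rw [weightFiltration_of_three_le _ _ _ (by omega)]
      exact anti (by omega)
  · rcases Nat.lt_or_ge i 2 with hi | hi
    · exact hbig (htop _) hj (by omega) (by omega)
    · rcases hi.eq_or_lt with rfl | hi
      · exact hbig le2 hj (by omega) (by omega)
      · exact hbig (weightFiltration_of_three_le _ _ _ hi).le hj (by omega) (by omega)

end Filtration

/-! ### Triangular products, witnesses and the `J`-property -/

section Witness

variable {G : Type*} [Group G]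

local notation "L" => Subgroup.lowerCentralSeries (⊤ : Subgroup G)

theorem mulDiff_prod_range (g : ℕ → G) :
    mulDiff (fun n => ((List.range n).map g).prod) = g := by
  funext n
  simp [mulDiff, List.range_succ]

/-- The partial products of the conjugates of `x` by the triangular powers of `k`. -/
def triangularProd (x k : G) (n : ℕ) : G :=
  ((List.range n).map fun j => (k ^ (j + 1).choose 2)⁻¹ * x * k ^ (j + 1).choose 2).prod

/-- The derivative is a conjugate of `x`, of weight 1, by `k ^ (C(n, 1) + C(n, 2))`, which is
polynomial because `k` has weight 2. -/
theorem isPolySeq_triangularProd (x : G) {k : G} {d : ℕ} (hk : k ∈ L d) (j : ℕ) :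
    IsPolySeq (weightFiltration x k d) j 0 (triangularProd x k) := by
  have anti := weightFiltration_antitone x k d
  have hx : x ∈ weightFiltration x k d 1 := Subgroup.subset_closure (Or.inl (by simp))
  have hk2 : k ∈ weightFiltration x k d 2 := Subgroup.subset_closure (Or.inl (by simp))
  have hx0 : x ∈ weightFiltration x k d 0 := hx
  have hk0 : k ∈ weightFiltration x k d 0 := anti (Nat.zero_le 2) hk2
  have hmem : ∀ n, triangularProd x k n ∈ weightFiltration x k d 0 := fun n => by
    refine Subgroup.list_prod_mem _ fun y hy => ?_
    obtain ⟨i, -, rfl⟩ := List.mem_map.1 hy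
    exact mul_mem (mul_mem (inv_mem (pow_mem hk0 _)) hx0) (pow_mem hk0 _)
  cases j with
  | zero => exact hmem
  | succ j =>
    refine ⟨hmem, ?_⟩
    have H := polyClosed anti (commutator_weightFiltration_le x hk) j
    have hT : IsPolySeq (weightFiltration x k d) j 0 fun n => k ^ (n + 1).choose 2 := by
      have h1 := isPolySeq_pow_choose (s := 0) (m := 1) anti (anti (by omega) hk2) j
      have h2 := isPolySeq_pow_choose (s := 0) (m := 2) anti hk2 j
      convert H.mul h1 h2 using 1
      funext n
      rw [Pi.mul_apply, ← pow_add, Nat.choose_succ_succ']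
    have := H.conj anti (H.inv hT) (isPolySeq_const hx j)
    rw [inv_inv] at this
    rw [show mulDiff (triangularProd x k) = _ from mulDiff_prod_range _]
    exact this

theorem triangularProd_eq_one {c d : ℕ} (hc : L c = ⊥) {x k : G} (hk : k ∈ L d) {n : ℕ}
    (hn : Odd n) (hexp : ∀ y : G, y ^ n = 1)
    (hhigh : ∀ i, 3 ≤ i → i < 2 * c → ∀ y ∈ L (d + 1), y ^ n.choose i = 1) :
    triangularProd x k n = 1 := by
  obtain ⟨a, ha, h⟩ := IsPolySeq.exists_taylor (weightFiltration_antitone x k d)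
    (commutator_weightFiltration_le x hk) (isPolySeq_triangularProd x hk) (n + 1)
  rw [h n (Nat.lt_succ_self n)]
  refine List.prod_eq_one fun y hy => ?_
  obtain ⟨i, -, rfl⟩ := List.mem_map.1 hy
  -- Evaluating the expansion at 0, where the product is empty, gives `a 0 = 1`.
  rcases Nat.eq_zero_or_pos i with rfl | hi
  · have h0 := h 0 (Nat.succ_pos n)
    rw [List.range_succ_eq_map] at h0
    simpa [triangularProd, Function.comp_def] using h0.symm
  rcases Nat.lt_or_ge i 3 with hi3 | hi3
  · have hdvd : n ∣ n.choose i := by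
      obtain rfl | rfl : i = 1 ∨ i = 2 := by omega
      · simp
      · obtain ⟨m, rfl⟩ := hn
        rw [Nat.choose_two_right, Nat.add_sub_cancel, Nat.mul_div_assoc _ (Dvd.intro m rfl)]
        exact Dvd.intro _ rfl
    obtain ⟨m, hm⟩ := hdvd
    rw [hm, pow_mul, hexp, one_pow]
  have hai := ha i
  rw [weightFiltration_of_three_le _ _ _ hi3] at hai
  rcases Nat.lt_or_ge i (2 * c) with hic | hic
  · exact hhigh i hi3 hic _ (Subgroup.lowerCentralSeries_antitone _ (le_max_left _ _) hai)
  · have := Subgroup.lowerCentralSeries_antitone _ (show c ≤ max (d + 1) (i / 2) by omega) hai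
    rw [hc, Subgroup.mem_bot] at this
    rw [this, one_pow]

theorem prod_range'_eq_triangularProd (x k : G) {m : ℕ} (hm : m ≤ orderOf k) :
    ((List.range' 1 m).map fun i => x * k ^ (orderOf k - i)).prod =
      triangularProd x k m * (k ^ (m + 1).choose 2)⁻¹ := by
  induction m with
  | zero => simp [triangularProd]
  | succ m ih =>
    have hk : k ^ (orderOf k - (m + 1)) = (k ^ (m + 1))⁻¹ := by
      rw [eq_inv_iff_mul_eq_one, ← pow_add, Nat.sub_add_cancel hm, pow_orderOf_eq_one]
    have hT : (k ^ (m + 1 + 1).choose 2)⁻¹ = (k ^ (m + 1).choose 2)⁻¹ * (k ^ (m + 1))⁻¹ := by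
      rw [Nat.choose_succ_succ' (m + 1) 1, Nat.choose_one_right, pow_add, mul_inv_rev]
    rw [List.range'_concat, List.map_append, List.prod_append, ih (by omega), triangularProd,
      triangularProd, List.range_succ, List.map_append, List.prod_append, hT]
    simp only [List.map_cons, List.map_nil, List.prod_singleton, one_mul, add_comm 1 m, hk]
    group

theorem isWitness_of_triangularProd_eq_one {k : G} (hk : Odd (orderOf k))
    (h : ∀ x : G, triangularProd x k (orderOf k) = 1) : IsWitness k := by
  refine ⟨orderOf_pos_iff.1 hk.pos, fun x => ?_⟩
  rw [prod_range'_eq_triangularProd x k le_rfl, h x, one_mul, inv_eq_one,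
    ← orderOf_dvd_iff_pow_eq_one]
  obtain ⟨m, hm⟩ := hk
  rw [Nat.choose_two_right, hm]
  exact ⟨m + 1, Nat.div_eq_of_eq_mul_left two_pos (by rw [Nat.add_sub_cancel]; ring)⟩

/-- The descending product `(x k^(j-1)) ⋯ (x k) x`. -/
def descProd (x k : G) : ℕ → G
  | 0 => 1
  | j + 1 => x * k ^ j * descProd x k j

theorem prod_range'_mul_descProd (x k : G) {n m : ℕ} (hm : m ≤ n) :
    ((List.range' 1 m).map fun i => x * k ^ (n - i)).prod * descProd x k (n - m) =
      descProd x k n := by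
  induction m with
  | zero => simp
  | succ m ih =>
    rw [← ih (by omega), List.range'_concat, List.map_append, List.prod_append, mul_assoc]
    congr 1
    rw [show n - m = n - (m + 1) + 1 by omega, descProd]
    simp [add_comm 1 m]

theorem IsWitness.descProd_orderOf {k : G} (hk : IsWitness k) (x : G) :
    descProd x k (orderOf k) = 1 := by
  rw [← prod_range'_mul_descProd x k le_rfl, hk.2 x]
  simp [descProd]

theorem IsWitness.periodic_descProd {k : G} (hk : IsWitness k) (x : G) :
    Function.Periodic (descProd x k) (orderOf k) := by
  intro j
  induction j with
  | zero => rw [Nat.zero_add, hk.descProd_orderOf, descProd]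
  | succ j ih =>
    rw [Nat.add_right_comm, descProd, ih, descProd, pow_add, pow_orderOf_eq_one, mul_one]

/-- On a coset `r⟨k⟩` the recursion forces `f (r k^j) = (r k^(j-1)) ⋯ r` once `f r = 1`; the witness
property makes this depend only on `j` modulo the order of `k`. -/
theorem IsWitness.isJGroup {k : G} (hk : IsWitness k) : IsJGroup G := by
  let r : G → G := fun x => (QuotientGroup.mk x : G ⧸ Subgroup.zpowers k).out
  have hr : ∀ x, ∃ j : ℕ, r x * k ^ j = x := fun x => by
    have h1 : (r x)⁻¹ * x ∈ Subgroup.zpowers k := by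
      rw [← QuotientGroup.eq]
      exact Quotient.out_eq _
    rw [← hk.1.mem_powers_iff_mem_zpowers] at h1
    obtain ⟨j, hj⟩ := h1
    exact ⟨j, by simp [hj]⟩
  choose e he using hr
  refine ⟨k, fun x => descProd (r x) k (e x), fun x => ?_⟩
  have hrk : r (x * k) = r x := by
    have : (QuotientGroup.mk (x * k) : G ⧸ Subgroup.zpowers k) = QuotientGroup.mk x := by
      simp
    simp only [r, this]
  have hmod : e (x * k) ≡ e x + 1 [MOD orderOf k] := by
    rw [← pow_eq_pow_iff_modEq]
    apply mul_left_cancel (a := r x)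
    rw [pow_succ, ← mul_assoc, he x]
    nth_rw 1 [← hrk]
    exact he _
  dsimp only
  rw [hrk, ← (hk.periodic_descProd (r x)).map_mod_nat, hmod,
    (hk.periodic_descProd (r x)).map_mod_nat, descProd, he x]

end Witness

/-! ### Divisibility of binomial coefficients and big elements of `p`-groups -/

section PGroup

theorem Nat.pow_dvd_choose_mul (p e i : ℕ) : p ^ e ∣ (p ^ e).choose i * i := by
  rcases Nat.eq_zero_or_pos (p ^ e) with h0 | h0
  · rcases Nat.eq_zero_or_pos i with rfl | hi
    · simp
    · simp [h0, Nat.choose_eq_zero_of_lt hi]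
  cases i with
  | zero => simp
  | succ i =>
    -- Absorption: `i * C(N, i) = N * C(N - 1, i - 1)`.
    obtain ⟨n, hn⟩ := Nat.exists_eq_add_of_le' h0
    rw [hn, ← Nat.add_one_mul_choose_eq]
    exact Dvd.intro _ rfl

theorem Nat.Prime.pow_dvd_choose_of_not_dvd {p : ℕ} (hp : p.Prime) (e : ℕ) {i : ℕ}
    (hi : ¬ p ∣ i) : p ^ e ∣ (p ^ e).choose i :=
  (((hp.coprime_iff_not_dvd.2 hi).pow_left e).dvd_of_dvd_mul_right) (Nat.pow_dvd_choose_mul p e i)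

theorem Nat.Prime.pow_dvd_choose_of_lt_sq {p : ℕ} (hp : p.Prime) (e : ℕ) {i : ℕ}
    (hi0 : 0 < i) (hi : i < p ^ 2) : p ^ e ∣ (p ^ (e + 1)).choose i := by
  by_cases h : p ∣ i
  · obtain ⟨j, rfl⟩ := h
    have hj0 : 0 < j := Nat.pos_of_mul_pos_left hi0
    have hj : ¬ p ∣ j := fun hd => by
      have h1 := Nat.le_of_dvd hj0 hd
      rw [pow_two] at hi
      exact absurd (Nat.lt_of_mul_lt_mul_left hi) (by omega)
    have h1 := Nat.pow_dvd_choose_mul p (e + 1) (p * j)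
    rw [Nat.mul_left_comm, pow_succ', Nat.mul_dvd_mul_iff_left hp.pos] at h1
    rw [pow_succ']
    exact ((hp.coprime_iff_not_dvd.2 hj).pow_left e).dvd_of_dvd_mul_right h1
  · exact (pow_dvd_pow p (Nat.le_succ e)).trans (hp.pow_dvd_choose_of_not_dvd (e + 1) h)

variable {G : Type*} [Group G] [Finite G] {p : ℕ} [hp : Fact p.Prime]

theorem IsPGroup.bigElements_nonempty (hG : IsPGroup p G) : (bigElements G).Nonempty := by
  obtain ⟨e, he⟩ := hG.exists_exponent_eq_pow
  cases e with
  | zero =>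
    exact ⟨1, by simpa [bigElements] using he.symm⟩
  | succ e =>
    by_contra hne
    have h : ∀ g : G, g ^ p ^ e = 1 := fun g => by
      by_contra hg
      refine hne ⟨g, ?_⟩
      rw [bigElements, Set.mem_ofPred_eq, he]
      exact orderOf_eq_prime_pow hg (he ▸ Monoid.pow_exponent_eq_one g)
    have := Monoid.exponent_dvd_of_forall_pow_eq_one h
    rw [he, Nat.pow_dvd_pow_iff_le_right hp.out.one_lt] at this
    omega

local notation "L" => Subgroup.lowerCentralSeries (⊤ : Subgroup G)

theorem IsPGroup.isWitness_of_orderOf_eq_exponent (hG : IsPGroup p G) (hodd : Odd p) {c d : ℕ}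
    (hc : L c = ⊥) {k : G} (hk : k ∈ L d) (hord : orderOf k = Monoid.exponent G)
    (hhigh : ∀ i, 3 ≤ i → i < 2 * c → ∀ y ∈ L (d + 1), y ^ (Monoid.exponent G).choose i = 1) :
    IsWitness k := by
  obtain ⟨e, he⟩ := hG.exists_exponent_eq_pow
  have hn : Odd (orderOf k) := by
    rw [hord, he]
    exact hodd.pow
  refine isWitness_of_triangularProd_eq_one hn fun x => ?_
  refine triangularProd_eq_one hc hk hn (fun y => ?_) ?_
  · rw [hord]
    exact Monoid.pow_exponent_eq_one y
  · rw [hord]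
    exact hhigh

theorem IsPGroup.isWitness_of_lt (hG : IsPGroup p G) (hodd : Odd p) {c : ℕ} (hc : L c = ⊥)
    (hcp : 2 * c ≤ p) {k : G} (hord : orderOf k = Monoid.exponent G) : IsWitness k := by
  refine hG.isWitness_of_orderOf_eq_exponent hodd hc (d := 0) (Subgroup.mem_top k) hord
    fun i hi hic y _ => ?_
  obtain ⟨e, he⟩ := hG.exists_exponent_eq_pow
  have h := hp.out.pow_dvd_choose_of_not_dvd e (Nat.not_dvd_of_pos_of_lt (by omega : 0 < i)
    (by omega : i < p))
  rw [← he] at h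
  exact orderOf_dvd_iff_pow_eq_one.1 ((Monoid.order_dvd_exponent y).trans h)

theorem IsPGroup.isWitness_of_lt_sq (hG : IsPGroup p G) (hodd : Odd p) {c d : ℕ} (hc : L c = ⊥)
    (hcp : 2 * c ≤ p ^ 2) {k : G} (hk : k ∈ L d) (hord : orderOf k = Monoid.exponent G)
    (hd : Monoid.exponent (L (d + 1)) ≠ Monoid.exponent G) : IsWitness k := by
  refine hG.isWitness_of_orderOf_eq_exponent hodd hc hk hord fun i hi hic y hy => ?_
  obtain ⟨e, he⟩ := hG.exists_exponent_eq_pow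
  have hdvd : Monoid.exponent (L (d + 1)) ∣ p ^ e :=
    he ▸ Monoid.exponent_dvd_of_monoidHom (L (d + 1)).subtype (Subgroup.subtype_injective _)
  obtain ⟨f, hfe, hf⟩ := (Nat.dvd_prime_pow hp.out).1 hdvd
  have hfe' : f ≠ e := fun h => hd (by rw [hf, he, h])
  -- A strictly smaller exponent of `L (d + 1)` divides `exp G / p`, which still divides `C(exp G,
  -- i)` for `0 < i < p ^ 2`.
  obtain ⟨e, rfl⟩ := Nat.exists_eq_succ_of_ne_zero (show e ≠ 0 by omega)
  have h : orderOf (⟨y, hy⟩ : L (d + 1)) ∣ p ^ e :=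
    (Monoid.order_dvd_exponent _).trans (hf ▸ pow_dvd_pow p (by omega))
  rw [Subgroup.orderOf_mk] at h
  rw [← orderOf_dvd_iff_pow_eq_one, he]
  exact h.trans (hp.out.pow_dvd_choose_of_lt_sq e (by omega) (by omega))

end PGroup

theorem theorem4 {G : Type*} [Group G] [Finite G] (p : ℕ) [Fact p.Prime] (hp : Odd p)
    (hG : IsPGroup p G) (c : ℕ) (hc : Group.nilpotencyClass G = c) :
    (2 * (c : ℤ) - 1 < (p : ℤ) → bigElements G ⊆ witnesses G ∧ IsJGroup G) ∧
    (2 * (c : ℤ) - 1 < (p : ℤ) ^ 2 →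
      (Nontrivial G → ∃ d : ℕ,
        IsGreatest {i : ℕ | 1 ≤ i ∧ Monoid.exponent (gam G i) = Monoid.exponent G} d) ∧
      (∀ d : ℕ,
        IsGreatest {i : ℕ | 1 ≤ i ∧ Monoid.exponent (gam G i) = Monoid.exponent G} d →
        ((↑) : gam G d → G) '' bigElements (gam G d) ⊆ witnesses G) ∧
      IsJGroup G) := by
  have hnil : Group.IsNilpotent G := hG.isNilpotent
  have hbot : (⊤ : Subgroup G).lowerCentralSeries c = ⊥ := by
    rw [← hc]
    exact Subgroup.lowerCentralSeries_nilpotencyClass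
  refine ⟨fun h => ?_, fun h => ?_⟩
  · have hw : bigElements G ⊆ witnesses G := fun k hk =>
      hG.isWitness_of_lt hp hbot (by omega) hk
    obtain ⟨k, hk⟩ := hG.bigElements_nonempty
    exact ⟨hw, (hw hk).isJGroup⟩
  · have hcp : 2 * c ≤ p ^ 2 := by
      have : (2 * (c : ℤ)) ≤ (p : ℤ) ^ 2 := by omega
      exact_mod_cast this
    have hex : Nontrivial G → ∃ d : ℕ,
        IsGreatest {i : ℕ | 1 ≤ i ∧ Monoid.exponent (gam G i) = Monoid.exponent G} d := by
      intro hnt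
      have hbdd : BddAbove {i : ℕ | 1 ≤ i ∧ Monoid.exponent (gam G i) = Monoid.exponent G} := by
        refine ⟨c, fun i hi => ?_⟩
        by_contra hic
        have hi1 : gam G i = ⊥ := by
          rw [gam, eq_bot_iff, ← hbot]
          exact Subgroup.lowerCentralSeries_antitone _ (by omega)
        have h1 : Monoid.exponent G = 1 := by
          rw [← hi.2, hi1]
          exact Monoid.exp_eq_one_iff.2 inferInstance
        exact not_subsingleton G (Monoid.exp_eq_one_iff.1 h1)
      have hne : {i : ℕ | 1 ≤ i ∧ Monoid.exponent (gam G i) = Monoid.exponent G}.Nonempty :=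
        ⟨1, le_rfl, Monoid.exponent_eq_of_mulEquiv Subgroup.topEquiv⟩
      exact ⟨_, Nat.sSup_mem hne hbdd, fun i hi => le_csSup hbdd hi⟩
    have hw : ∀ d : ℕ,
        IsGreatest {i : ℕ | 1 ≤ i ∧ Monoid.exponent (gam G i) = Monoid.exponent G} d →
        ((↑) : gam G d → G) '' bigElements (gam G d) ⊆ witnesses G := by
      rintro d ⟨⟨hd1, hd⟩, hmax⟩ - ⟨k, hk, rfl⟩
      -- `gam G d` is `L (d - 1)`, so maximality of `d` says precisely that the next term has
      -- smaller exponent.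
      refine hG.isWitness_of_lt_sq hp hbot hcp (d := d - 1) k.2 ?_ fun hd' => ?_
      · rw [Subgroup.orderOf_coe, ← hd]
        exact hk
      · have : d + 1 ≤ d := hmax ⟨by omega, by
          rw [gam, Nat.add_sub_cancel, ← hd', Nat.sub_add_cancel hd1]⟩
        omega
    refine ⟨hex, hw, ?_⟩
    rcases subsingleton_or_nontrivial G with hs | hnt
    · exact ⟨1, id, fun x => Subsingleton.elim _ _⟩
    · obtain ⟨d, hd⟩ := hex hnt
      obtain ⟨k, hk⟩ := (hG.to_subgroup (gam G d)).bigElements_nonempty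
      exact (hw d hd ⟨k, hk, rfl⟩).isJGroup
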